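/- Let $\lambda=(\lambda_1\ge\dots\ge\lambda_d>0)$ be a partition with $d=\ell(\lambda)$ parts and let $\mu$ be a partition with $[\mu]\subseteq[\lambda]$ (put $\mu_j=0$ for $j>\ell(\mu)$); let $\lambda',\mu'$ be the conjugate partitions. Let $c(u)=j-i$ be the content of a cell $u=(i,j)$, and let $\mathrm{SSYT}(\mu,d)$ be the set of semistandard Young tableaux of shape $\mu$ with entries in $\{1,\dots,d\}$. The terms of the Okounkov--Olshanski formula for $\lambda/\mu$ are the products $$\prod_{u\in[\mu]}\bigl(\lambda_{d+1-T(u)}-c(u)\bigr),\qquad T\in\mathrm{SSYT}(\mu,d).$$ Let $\mathrm{OOT}(\lambda/\mu)$ be the number of $T\in\mathrm{SSYT}(\mu,d)$ with $c(u)<\lambda_{d+1-T(u)}$ for all $u\in[\mu]$. Then the number of $T\in\mathrm{SSYT}(\mu,d)$ whose term is nonzero is $$\mathrm{OOT}(\lambda/\mu)=\det\left[\binom{\lambda_i-\mu_j+j-1}{i-1}\right]_{i,j=1}^{d}=\det\left[\binom{\lambda'_i}{\mu'_j+i-j}\right]_{i,j=1}^{\mu_1},$$ where $\binom{n}{k}=0$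 unless $0\le k\le n$ (in particular for negative $n$), and the determinant of a $0\times 0$ matrix is $1$. -/

import Mathlib

namespace OkounkovOlshanski

/-- The content `c(u) = j - i` of the cell `u = (i, j)`. Cells are indexed from `(0, 0)`, as
everywhere for `YoungDiagram`; contents do not change under this shift. -/
def content (u : ℕ × ℕ) : ℤ := (u.2 : ℤ) - (u.1 : ℤ)

/-- `SSYT(μ, d)`: the semistandard Young tableaux of shape `μ` with all entries in `{1, …, d}`. -/
def ssyt (μ : YoungDiagram) (d : ℕ) : Set (SemistandardYoungTableau μ) :=
  {T | ∀ i j : ℕ, (i, j) ∈ μ → 1 ≤ T i j ∧ T i j ≤ d}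

/-- There are only finitely many such tableaux, so that `Set.ncard` of a subset is its size. -/
theorem ssyt_finite (μ : YoungDiagram) (d : ℕ) : (ssyt μ d).Finite := by
  classical
  let F : SemistandardYoungTableau μ → (μ.cells → ℕ) := fun T u => T u.1.1 u.1.2
  have hF : Function.Injective F := by
    intro T T' h
    ext i j
    by_cases hc : (i, j) ∈ μ
    · exact congrFun h ⟨(i, j), hc⟩
    · rw [T.zeros hc, T'.zeros hc]
  refine Set.Finite.of_finite_image (f := F) ?_ hF.injOn
  refine (Set.finite_Icc (0 : μ.cells → ℕ) (fun _ => d)).subset ?_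
  rintro _ ⟨T, hT, rfl⟩
  exact ⟨fun _ => Nat.zero_le _, fun u => (hT u.1.1 u.1.2 u.2).2⟩

/-- The weight `λ_{d + 1 - T(u)} - c(u)` of the cell `u`, where `d = ℓ(λ)` is the number of
(nonzero) parts of `λ`, that is, the length of the first column. As `rowLen` counts rows from `0`,
the part `λ_{d + 1 - T(u)}` is `lam.rowLen (d - T(u))`. -/
def weight (lam : YoungDiagram) {mu : YoungDiagram} (T : SemistandardYoungTableau mu)
    (u : ℕ × ℕ) : ℤ :=
  (lam.rowLen (lam.colLen 0 - T u.1 u.2) : ℤ) - content u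

/-- The term of the Okounkov--Olshanski formula for `λ/μ` that is indexed by `T`: the product of
the weights of all cells of `μ`. -/
def term (lam : YoungDiagram) {mu : YoungDiagram} (T : SemistandardYoungTableau mu) : ℤ :=
  ∏ u ∈ mu.cells, weight lam T u

/-- The tableaux `T ∈ SSYT(μ, d)` that index a nonzero term of the formula. -/
def nonzeroTerms (lam mu : YoungDiagram) : Set (SemistandardYoungTableau mu) :=
  {T | T ∈ ssyt mu (lam.colLen 0) ∧ term lam T ≠ 0}

/-- The Okounkov--Olshanski tableaux of shape `λ/μ`: the `T ∈ SSYT(μ, d)` with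
`c(u) < λ_{d + 1 - T(u)}` for all cells `u` of `μ`. -/
def ooTableaux (lam mu : YoungDiagram) : Set (SemistandardYoungTableau mu) :=
  {T | T ∈ ssyt mu (lam.colLen 0) ∧
    ∀ u ∈ mu.cells, content u < (lam.rowLen (lam.colLen 0 - T u.1 u.2) : ℤ)}

/-- `OOT(λ/μ)`, the number of Okounkov--Olshanski tableaux. -/
noncomputable def oot (lam mu : YoungDiagram) : ℕ := (ooTableaux lam mu).ncard

/-- The binomial coefficient of two integers, with the combinatorial convention that it is zero
unless `0 ≤ k ≤ n`. -/
def binom (n k : ℤ) : ℤ := if 0 ≤ k ∧ k ≤ n then (n.toNat.choose k.toNat : ℤ) else 0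

end OkounkovOlshanski

/-! Fix a monotone flag `a` and count the tableaux of shape μ with entries in {1, …, d} and c(u) <
a(T(u)); the theorem is the case a(k) = λ_{d+1-k}. The cells holding d+1 form a horizontal strip
μ/ν. If μ₁ ≤ a(d+1), their flag condition is automatic, so the count for (d+1, μ) is the sum over ν
of the counts for (d, ν) (`ncard_flagged_succ`); otherwise the last cell of the first row rules out
every tableau. Both determinants obey this recursion. In the row formula, differences of adjacent
columns are hockey stick sums over μ_{j+1} ≤ ν_j ≤ μ_j (`det_rowMatrix_succ`). In the column
formula, Pascal's rule lets each column length drop by 0 or 1, and choices that are not partitions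
give two equal columns (`det_colMatrix_pascal`, `det_eq_zero_of_not_antitone`). Nonzero terms have
positive factors because weights fall by at most one per step along a row (`weight_pos`). -/

namespace OkounkovOlshanski

/-! ### Binomial identities and multilinear expansion. -/

theorem binom_of_neg {n : ℤ} (hn : n < 0) (k : ℤ) : binom n k = 0 :=
  if_neg (by omega)

theorem binom_of_lt {n k : ℤ} (h : n < k) : binom n k = 0 :=
  if_neg (by omega)

theorem binom_of_right_neg (n : ℤ) {k : ℤ} (h : k < 0) : binom n k = 0 :=
  if_neg (by omega)

theorem binom_zero_right {n : ℤ} (hn : 0 ≤ n) : binom n 0 = 1 := by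
  simp [binom, hn]

theorem binom_natCast (n k : ℕ) : binom n k = (n.choose k : ℤ) := by
  unfold binom
  split_ifs with h
  · simp
  · rw [Nat.choose_eq_zero_of_lt (by omega), Nat.cast_zero]

/-- Pascal's rule for a nonnegative upper index. -/
theorem binom_add_one {n : ℤ} (hn : 0 ≤ n) (k : ℤ) :
    binom (n + 1) k = binom n (k - 1) + binom n k := by
  obtain ⟨n, rfl⟩ := Int.eq_ofNat_of_zero_le hn
  rcases lt_trichotomy k 0 with hk | rfl | hk
  · rw [binom_of_right_neg _ hk, binom_of_right_neg _ hk, binom_of_right_neg _ (by omega), add_zero]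
  · rw [binom_zero_right (by omega), binom_zero_right (by omega), binom_of_right_neg _ (by omega),
      zero_add]
  · obtain ⟨k, rfl⟩ : ∃ m : ℕ, k = ((m + 1 : ℕ) : ℤ) := ⟨k.toNat - 1, by omega⟩
    have e : (((k + 1 : ℕ) : ℤ) - 1) = (k : ℤ) := by push_cast; ring
    have e' : ((n : ℤ) + 1) = ((n + 1 : ℕ) : ℤ) := by push_cast; ring
    rw [e, e', binom_natCast, binom_natCast, binom_natCast,
      Nat.choose_succ_succ]
    push_cast
    ring

/-- Pascal's rule for a nonnegative lower index. -/
theorem binom_add_one_add_one (n : ℤ) {k : ℤ} (hk : 0 ≤ k) :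
    binom (n + 1) (k + 1) = binom n k + binom n (k + 1) := by
  rcases lt_or_ge n 0 with hn | hn
  -- The case n = -1 survives because k + 1 > 0, so the left side is not binom 0 0.
  · rw [binom_of_neg hn, binom_of_neg hn, binom_of_lt (by omega), add_zero]
  · rw [binom_add_one hn, add_sub_cancel_right]

/-- The hockey stick identity. -/
theorem binom_sub_binom {a b : ℕ} (hab : a ≤ b) (l : ℤ) {k : ℤ} (hk : 0 ≤ k) :
    binom (l - a + 1) (k + 1) - binom (l - b) (k + 1) = ∑ x ∈ Finset.Icc a b, binom (l - x) k := by
  induction b, hab using Nat.le_induction with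
  | base =>
    rw [Finset.Icc_self, Finset.sum_singleton, binom_add_one_add_one _ hk]
    ring
  | succ b hab ih =>
    rw [Finset.sum_Icc_succ_top (by omega), ← ih]
    have := binom_add_one_add_one (l - (b + 1 : ℕ)) hk
    rw [show l - (b + 1 : ℕ) + 1 = l - b by push_cast; ring] at this
    rw [this]
    ring

/-- Multilinearity of the determinant in the columns. -/
theorem det_sum_columns {R : Type*} [CommRing R] {n : ℕ} {α : Type*} (A : Fin n → Finset α)
    (g : Fin n → Fin n → α → R) :
    (Matrix.of fun i j => ∑ x ∈ A j, g i j x).det =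
      ∑ r ∈ Fintype.piFinset A, (Matrix.of fun i j => g i j (r j)).det := by
  classical
  have h := (Matrix.detRowAlternating (n := Fin n) (R := R)).toMultilinearMap.map_sum_finset
    (fun j x i => g i j x) A
  rw [← Matrix.det_transpose]
  refine Eq.trans (congrArg Matrix.det ?_)
    (h.trans (Finset.sum_congr rfl fun r _ => Matrix.det_transpose _))
  ext j i
  simp [Finset.sum_apply]

/-! ### Recursions for the two determinants. -/

/-- The matrix of the row formula. -/
def rowMatrix (d : ℕ) (l : ℕ → ℤ) (m : ℕ → ℕ) : Matrix (Fin d) (Fin d) ℤ :=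
  Matrix.of fun i j => binom (l i - m j + (j : ℕ)) (i : ℕ)

theorem det_rowMatrix_eq_zero {d : ℕ} {l : ℕ → ℤ} {m : ℕ → ℕ} (h : ∀ i ≤ d, l i < m 0) :
    (rowMatrix (d + 1) l m).det = 0 := by
  refine Matrix.det_eq_zero_of_column_eq_zero 0 fun i => ?_
  refine binom_of_neg ?_ _
  have := h i (by omega)
  simp only [Fin.val_zero, Nat.cast_zero]
  omega

/-- Row 0 consists of ones, so subtracting from each column its predecessor leaves (1, 0, …, 0)
there. Expanding along it leaves hockey stick sums, which multilinearity pulls out. -/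
theorem det_rowMatrix_succ {d : ℕ} {l : ℕ → ℤ} {m : ℕ → ℕ} (hm : Antitone m) (h : m 0 ≤ l 0) :
    (rowMatrix (d + 1) l m).det =
      ∑ r ∈ Fintype.piFinset fun j : Fin d => Finset.Icc (m (j + 1)) (m j),
        (Matrix.of fun i j : Fin d => binom (l (i + 1) - r j + (j : ℕ)) (i : ℕ)).det := by
  let B : Matrix (Fin (d + 1)) (Fin (d + 1)) ℤ := Matrix.of fun i =>
    Fin.cons (rowMatrix (d + 1) l m i 0)
      fun j => rowMatrix (d + 1) l m i j.succ - rowMatrix (d + 1) l m i j.castSucc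
  have hone : ∀ j, rowMatrix (d + 1) l m 0 j = 1 := fun j => by
    have : m j ≤ m 0 := hm (Nat.zero_le _)
    simp only [rowMatrix, Matrix.of_apply, Fin.val_zero, Nat.cast_zero]
    exact binom_zero_right (by omega)
  have hdet : (rowMatrix (d + 1) l m).det = B.det :=
    Matrix.det_eq_of_forall_col_eq_smul_add_pred (fun _ => 1) (fun i => by simp [B])
      (fun i j => by simp [B])
  rw [hdet, Matrix.det_succ_row_zero, Fin.sum_univ_succ, Finset.sum_eq_zero fun j _ => by
    simp [B, hone]]
  have hsub : B.submatrix Fin.succ (Fin.succAbove 0) = Matrix.of fun i j : Fin d =>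
      ∑ x ∈ Finset.Icc (m (j + 1)) (m j), binom (l (i + 1) - x + (j : ℕ)) (i : ℕ) := by
    ext i j
    have := binom_sub_binom (hm (Nat.le_add_right (j : ℕ) 1)) (l (i + 1) + (j : ℕ))
      (Int.natCast_nonneg (i : ℕ))
    simp only [B, rowMatrix, Matrix.submatrix_apply, Matrix.of_apply, Fin.zero_succAbove,
      Fin.cons_succ, Fin.val_succ, Fin.val_castSucc, Nat.cast_add, Nat.cast_one]
    simp only [add_sub_right_comm] at this
    rw [← this]
    congr 2
    ring
  rw [hsub, det_sum_columns]
  simp [B, hone]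

/-- The matrix of the column formula. -/
def colMatrix (n : ℕ) (p q : ℕ → ℕ) : Matrix (Fin n) (Fin n) ℤ :=
  Matrix.of fun i j => binom (p i) (q j + (i : ℕ) - (j : ℕ))

/-- The last column is zero above a diagonal entry 1. This allows padding by empty columns of the
diagram. -/
theorem det_colMatrix_succ {n : ℕ} {p q : ℕ → ℕ} (h : q n = 0) :
    (colMatrix (n + 1) p q).det = (colMatrix n p q).det := by
  rw [Matrix.det_succ_column _ (Fin.last n), Fin.sum_univ_castSucc,
    Finset.sum_eq_zero fun i _ => ?_]
  · have e : (colMatrix (n + 1) p q).submatrix (Fin.last n).succAbove (Fin.last n).succAbove =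
        colMatrix n p q := by
      ext i j
      simp [colMatrix]
    have e1 : colMatrix (n + 1) p q (Fin.last n) (Fin.last n) = 1 := by
      simp only [colMatrix, Matrix.of_apply, Fin.val_last, h, Nat.cast_zero]
      rw [zero_add, sub_self, binom_zero_right (by omega)]
    rw [e, e1, zero_add, mul_one, ← two_mul, pow_mul]
    simp
  · have : colMatrix (n + 1) p q i.castSucc (Fin.last n) = 0 := by
      simp only [colMatrix, Matrix.of_apply, Fin.val_last, h, Nat.cast_zero, Fin.val_castSucc]
      exact binom_of_right_neg _ (by omega)
    simp [this]

theorem det_colMatrix_eq {k n : ℕ} {p q : ℕ → ℕ} (hkn : k ≤ n) (h : ∀ j, k ≤ j → q j = 0) :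
    (colMatrix n p q).det = (colMatrix k p q).det := by
  induction n, hkn using Nat.le_induction with
  | base => rfl
  | succ n hn ih => rw [det_colMatrix_succ (h n hn), ih]

theorem det_colMatrix_eq_zero {n : ℕ} {p q : ℕ → ℕ} (hp : p n = 0) (hq : ∀ j ≤ n, 0 < q j) :
    (colMatrix (n + 1) p q).det = 0 := by
  refine Matrix.det_eq_zero_of_row_eq_zero (Fin.last n) fun j => ?_
  have := hq j (by omega)
  simp only [colMatrix, Matrix.of_apply, Fin.val_last, hp]
  exact binom_of_lt (by omega)

theorem det_colMatrix_pascal {n : ℕ} {p p' q : ℕ → ℕ} (hp : ∀ i < n, p' i = p i + 1)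
    (hq : ∀ j < n, 0 < q j) :
    (colMatrix n p' q).det =
      ∑ r ∈ Fintype.piFinset fun j : Fin n => Finset.Icc (q j - 1) (q j),
        (Matrix.of fun i j : Fin n => binom (p i) (r j + (i : ℕ) - (j : ℕ))).det := by
  rw [← det_sum_columns (fun j : Fin n => Finset.Icc (q j - 1) (q j))
    fun (i j : Fin n) x => binom (p i) (x + (i : ℕ) - (j : ℕ))]
  congr 1
  ext i j
  have hj := hq j j.2
  have e : q j = (q j - 1) + 1 := by omega
  simp only [colMatrix, Matrix.of_apply]
  rw [hp i i.2, Nat.cast_add, Nat.cast_one, binom_add_one (by omega)]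
  conv_rhs => rw [e, Nat.add_sub_cancel, Finset.sum_Icc_succ_top (by omega), Finset.Icc_self,
    Finset.sum_singleton, ← e]
  congr 2
  omega

/-- In the expansion by Pascal's rule, the terms that do not come from partitions vanish. -/
theorem det_eq_zero_of_not_antitone {n : ℕ} {p q : ℕ → ℕ} (hq : Antitone q) {r : Fin n → ℕ}
    (hr : r ∈ Fintype.piFinset fun j : Fin n => Finset.Icc (q j - 1) (q j)) (h : ¬ Antitone r) :
    (Matrix.of fun i j : Fin n => binom (p i) (r j + (i : ℕ) - (j : ℕ))).det = 0 := by
  rcases n with _ | n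
  · exact absurd (fun i => i.elim0) h
  rw [Fin.antitone_iff_succ_le] at h
  push Not at h
  obtain ⟨j, hj⟩ := h
  simp only [Fintype.mem_piFinset, Finset.mem_Icc] at hr
  have h1 := hr j.castSucc
  have h2 := hr j.succ
  have h3 : q j.succ ≤ q j.castSucc := hq (by simp)
  refine Matrix.det_zero_of_column_eq (i := j.castSucc) (j := j.succ)
    (Fin.castSucc_lt_succ).ne fun k => ?_
  -- Indeed r_{j+1} ≤ q_{j+1} ≤ q_j ≤ r_j + 1, so an ascent is exactly 1; the shift by -j then makes
  -- the two columns agree.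
  have e : r j.succ = r j.castSucc + 1 := by omega
  simp only [Matrix.of_apply, e, Fin.val_succ, Fin.val_castSucc]
  congr 1
  push_cast
  ring

open YoungDiagram

/-! ### Flagged tableaux and removal of the largest letter. -/

/-- The tableaux of shape `mu` with entries in `{1, …, d}` and `c(u) < a (T(u))` for all cells. -/
def flagged (a : ℕ → ℕ) (d : ℕ) (mu : YoungDiagram) : Set (SemistandardYoungTableau mu) :=
  {T | T ∈ ssyt mu d ∧ ∀ u ∈ mu.cells, content u < (a (T u.1 u.2) : ℤ)}

theorem flagged_finite (a : ℕ → ℕ) (d : ℕ) (mu : YoungDiagram) : (flagged a d mu).Finite :=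
  (ssyt_finite mu d).subset fun _ hT => hT.1

theorem finite_le (mu : YoungDiagram) : {nu : YoungDiagram | nu ≤ mu}.Finite := by
  refine Set.Finite.of_finite_image (f := YoungDiagram.cells) ?_ fun _ _ _ _ h => YoungDiagram.ext h
  refine (mu.cells.powerset.finite_toSet).subset ?_
  rintro _ ⟨nu, hnu, rfl⟩
  exact Finset.mem_coe.2 (Finset.mem_powerset.2 (cells_subset_iff.2 hnu))

/-- The diagrams `nu ≤ mu` for which `mu / nu` is a horizontal strip. -/
noncomputable def stripComplements (mu : YoungDiagram) : Finset YoungDiagram :=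
  ((finite_le mu).inter_of_left {nu | ∀ i j, (i + 1, j) ∈ mu → (i, j) ∈ nu}).toFinset

theorem mem_stripComplements {mu nu : YoungDiagram} :
    nu ∈ stripComplements mu ↔ nu ≤ mu ∧ ∀ i j, (i + 1, j) ∈ mu → (i, j) ∈ nu := by
  simp [stripComplements]

theorem mem_stripComplements_iff_rowLen {mu nu : YoungDiagram} :
    nu ∈ stripComplements mu ↔
      ∀ i, mu.rowLen (i + 1) ≤ nu.rowLen i ∧ nu.rowLen i ≤ mu.rowLen i := by
  rw [mem_stripComplements]
  constructor
  · rintro ⟨h1, h2⟩ i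
    constructor
    · by_contra! h
      exact lt_irrefl _ (mem_iff_lt_rowLen.1 (h2 i _ (mem_iff_lt_rowLen.2 h)))
    · by_contra! h
      exact lt_irrefl _ (mem_iff_lt_rowLen.1 (h1 (mem_iff_lt_rowLen.2 h)))
  · intro h
    refine ⟨?_, fun i j hij => ?_⟩
    · rintro ⟨i, j⟩ hij
      exact mem_iff_lt_rowLen.2 ((mem_iff_lt_rowLen.1 hij).trans_le (h i).2)
    · exact mem_iff_lt_rowLen.2 ((mem_iff_lt_rowLen.1 hij).trans_le (h i).1)

theorem mem_stripComplements_iff_colLen {mu nu : YoungDiagram} :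
    nu ∈ stripComplements mu ↔
      ∀ j, mu.colLen j ≤ nu.colLen j + 1 ∧ nu.colLen j ≤ mu.colLen j := by
  rw [mem_stripComplements]
  constructor
  · rintro ⟨h1, h2⟩ j
    constructor
    · by_contra! h
      exact lt_irrefl _ (mem_iff_lt_colLen.1 (h2 _ j (mem_iff_lt_colLen.2 h)))
    · by_contra! h
      exact lt_irrefl _ (mem_iff_lt_colLen.1 (h1 (mem_iff_lt_colLen.2 h)))
  · intro h
    refine ⟨?_, fun i j hij => ?_⟩
    · rintro ⟨i, j⟩ hij
      exact mem_iff_lt_colLen.2 ((mem_iff_lt_colLen.1 hij).trans_le (h j).2)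
    · have := mem_iff_lt_colLen.1 hij
      have := (h j).1
      exact mem_iff_lt_colLen.2 (by omega)

section Peeling

variable {mu : YoungDiagram}

theorem entry_le_of_le (T : SemistandardYoungTableau mu) {i i' j j' : ℕ} (hi : i' ≤ i)
    (hj : j' ≤ j) (h : (i, j) ∈ mu) : T i' j' ≤ T i j :=
  (T.row_weak_of_le hj (mu.up_left_mem hi le_rfl h)).trans (T.col_weak hi h)

/-- The cells whose entries are at most `d`. -/
def lowerShape (d : ℕ) (T : SemistandardYoungTableau mu) : YoungDiagram where
  cells := mu.cells.filter fun u => T u.1 u.2 ≤ d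
  isLowerSet := by
    rintro ⟨i, j⟩ ⟨i', j'⟩ hle h
    simp only [Finset.coe_filter, Set.mem_ofPred_eq, mem_cells] at h ⊢
    exact ⟨mu.up_left_mem hle.1 hle.2 h.1, (entry_le_of_le T hle.1 hle.2 h.1).trans h.2⟩

theorem mem_lowerShape {d : ℕ} {T : SemistandardYoungTableau mu} {i j : ℕ} :
    (i, j) ∈ lowerShape d T ↔ (i, j) ∈ mu ∧ T i j ≤ d := by
  rw [← mem_cells, lowerShape, Finset.mem_filter, mem_cells]

theorem lowerShape_mem_stripComplements {d : ℕ} {T : SemistandardYoungTableau mu}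
    (hT : T ∈ ssyt mu (d + 1)) : lowerShape d T ∈ stripComplements mu := by
  refine mem_stripComplements.2 ⟨?_, fun i j h => ?_⟩
  · rintro ⟨i, j⟩ h
    exact (mem_lowerShape.1 h).1
  · have h1 := (hT _ _ h).2
    have h2 := T.col_strict (Nat.lt_add_one i) h
    exact mem_lowerShape.2 ⟨mu.up_left_mem (Nat.le_succ i) le_rfl h, by omega⟩

/-- The restriction of a tableau to a smaller diagram. -/
def restrict (nu : YoungDiagram) (h : nu ≤ mu) (T : SemistandardYoungTableau mu) :
    SemistandardYoungTableau nu where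
  entry i j := if (i, j) ∈ nu then T i j else 0
  row_weak' hj hc := by
    rw [if_pos hc, if_pos (nu.up_left_mem le_rfl hj.le hc)]
    exact T.row_weak hj (h hc)
  col_strict' hi hc := by
    rw [if_pos hc, if_pos (nu.up_left_mem hi.le le_rfl hc)]
    exact T.col_strict hi (h hc)
  zeros' hc := if_neg hc

theorem restrict_apply (nu : YoungDiagram) (h : nu ≤ mu) (T : SemistandardYoungTableau mu)
    (i j : ℕ) : restrict nu h T i j = if (i, j) ∈ nu then T i j else 0 := rfl

/-- The extension of a tableau by the letter `d + 1` on a horizontal strip. -/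
def extend {nu : YoungDiagram} (hnu : nu ∈ stripComplements mu) {d : ℕ}
    (S : SemistandardYoungTableau nu) (hS : S ∈ ssyt nu d) : SemistandardYoungTableau mu where
  entry i j := if (i, j) ∈ nu then S i j else if (i, j) ∈ mu then d + 1 else 0
  row_weak' {i j1 j2} hj hc := by
    have h1 := mu.up_left_mem le_rfl hj.le hc
    by_cases h2 : (i, j2) ∈ nu
    · rw [if_pos h2, if_pos (nu.up_left_mem le_rfl hj.le h2)]
      exact S.row_weak hj h2
    · rw [if_neg h2, if_pos hc, if_pos h1]
      split_ifs with h3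
      · have := (hS _ _ h3).2
        omega
      · exact le_rfl
  col_strict' {i1 i2 j} hi hc := by
    have h1 : (i1, j) ∈ nu :=
      (mem_stripComplements.1 hnu).2 i1 j (mu.up_left_mem hi le_rfl hc)
    rw [if_pos h1]
    split_ifs with h2
    · exact S.col_strict hi h2
    · have := (hS _ _ h1).2
      omega
  zeros' {i j} hc := by
    rw [if_neg fun h => hc ((mem_stripComplements.1 hnu).1 h), if_neg hc]

theorem extend_apply {nu : YoungDiagram} (hnu : nu ∈ stripComplements mu) {d : ℕ}
    (S : SemistandardYoungTableau nu) (hS : S ∈ ssyt nu d) (i j : ℕ) :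
    extend hnu S hS i j = if (i, j) ∈ nu then S i j else if (i, j) ∈ mu then d + 1 else 0 := rfl

end Peeling

/-- The flagged tableaux with prescribed `lowerShape d` are those of that shape. -/
theorem ncard_lowerShape_fiber {a : ℕ → ℕ} {d : ℕ} {mu nu : YoungDiagram}
    (h0 : mu.rowLen 0 ≤ a (d + 1)) (hnu : nu ∈ stripComplements mu) :
    {T ∈ flagged a (d + 1) mu | lowerShape d T = nu}.ncard = (flagged a d nu).ncard := by
  have hle := (mem_stripComplements.1 hnu).1
  refine Set.ncard_congr (fun T _ => restrict nu hle T) ?_ ?_ ?_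
  · rintro T ⟨hT, rfl⟩
    refine ⟨fun i j hij => ?_, fun ⟨i, j⟩ hij => ?_⟩
    · rw [restrict_apply, if_pos hij]
      exact ⟨(hT.1 i j (hle hij)).1, (mem_lowerShape.1 hij).2⟩
    · rw [mem_cells] at hij
      simp only [restrict_apply, if_pos hij]
      exact hT.2 (i, j) (hle hij)
  · rintro T T' ⟨hT, rfl⟩ ⟨hT', hs⟩ h
    ext i j
    have hij := congrArg (fun S => S i j) h
    simp only [restrict_apply] at hij
    by_cases hc : (i, j) ∈ lowerShape d T
    · rwa [if_pos hc, if_pos hc] at hij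
    · by_cases hm : (i, j) ∈ mu
      · have hc' := hc
        rw [← hs] at hc'
        rw [mem_lowerShape] at hc hc'
        have h1 := (hT.1 i j hm).2
        have h2 := (hT'.1 i j hm).2
        have h3 : ¬ T i j ≤ d := fun h => hc ⟨hm, h⟩
        have h4 : ¬ T' i j ≤ d := fun h => hc' ⟨hm, h⟩
        -- Outside the common lower shape both entries equal d + 1.
        omega
      · rw [T.zeros hm, T'.zeros hm]
  · intro S hS
    refine ⟨extend hnu S hS.1, ⟨⟨fun i j hij => ?_, fun ⟨i, j⟩ hij => ?_⟩, ?_⟩, ?_⟩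
    · rw [extend_apply]
      split_ifs with hc
      · have := hS.1 i j hc
        omega
      · omega
    · rw [mem_cells] at hij
      simp only [extend_apply, if_pos hij]
      split_ifs with hc
      · exact hS.2 (i, j) hc
      -- A new cell has content at most j < μ₁ ≤ a(d+1).
      · have h1 := mem_iff_lt_rowLen.1 hij
        have h2 := mu.rowLen_anti 0 i (Nat.zero_le _)
        simp only [content]
        omega
    · ext ⟨i, j⟩
      rw [mem_cells, mem_cells, mem_lowerShape, extend_apply]
      constructor
      · rintro ⟨hm, hd⟩
        by_contra hc
        rw [if_neg hc, if_pos hm] at hd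
        omega
      · intro hc
        rw [if_pos hc]
        exact ⟨hle hc, (hS.1 i j hc).2⟩
    · ext i j
      rw [restrict_apply, extend_apply]
      split_ifs with hc
      · rfl
      · exact (S.zeros hc).symm

theorem ncard_flagged_succ {a : ℕ → ℕ} {d : ℕ} {mu : YoungDiagram}
    (h0 : mu.rowLen 0 ≤ a (d + 1)) :
    (flagged a (d + 1) mu).ncard = ∑ nu ∈ stripComplements mu, (flagged a d nu).ncard := by
  classical
  have hfin := flagged_finite a (d + 1) mu
  rw [Set.ncard_eq_toFinset_card _ hfin,
    Finset.card_eq_sum_card_fiberwise (f := lowerShape d) (t := stripComplements mu) fun T hT =>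
      lowerShape_mem_stripComplements (hfin.mem_toFinset.1 hT).1]
  refine Finset.sum_congr rfl fun nu hnu => ?_
  rw [← ncard_lowerShape_fiber h0 hnu, ← Set.ncard_coe_finset]
  congr 1
  ext T
  simp

/-- The last cell of the first row has content μ₁ - 1 ≥ a(d), while its entry is at most d. -/
theorem flagged_eq_empty_of_lt {a : ℕ → ℕ} (ha : Monotone a) {d : ℕ} {mu : YoungDiagram}
    (h0 : a d < mu.rowLen 0) : flagged a d mu = ∅ := by
  refine Set.eq_empty_of_forall_notMem fun T hT => ?_
  have hc : (0, mu.rowLen 0 - 1) ∈ mu := mem_iff_lt_rowLen.2 (by omega)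
  have h1 := hT.2 _ hc
  have h2 := ha (hT.1 _ _ hc).2
  simp only [content] at h1
  omega

theorem lt_entry {mu : YoungDiagram} {d : ℕ} {T : SemistandardYoungTableau mu}
    (hT : T ∈ ssyt mu d) {i j : ℕ} (h : (i, j) ∈ mu) : i < T i j := by
  induction i with
  | zero => exact (hT _ _ h).1
  | succ i ih =>
    have h1 := ih (mu.up_left_mem (Nat.le_succ i) le_rfl h)
    have h2 := T.col_strict (Nat.lt_add_one i) h
    omega

theorem flagged_eq_empty_of_lt_colLen {a : ℕ → ℕ} {d : ℕ} {mu : YoungDiagram}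
    (h0 : d < mu.colLen 0) : flagged a d mu = ∅ := by
  refine Set.eq_empty_of_forall_notMem fun T hT => ?_
  have hc : (d, 0) ∈ mu := mem_iff_lt_colLen.2 h0
  have h1 := lt_entry hT.1 hc
  have h2 := (hT.1 _ _ hc).2
  omega

theorem ncard_flagged_bot (a : ℕ → ℕ) (d : ℕ) : (flagged a d ⊥).ncard = 1 := by
  rw [Set.ncard_eq_one]
  refine ⟨SemistandardYoungTableau.highestWeight ⊥, ?_⟩
  ext T
  simp only [Set.mem_singleton_iff]
  constructor
  · intro _
    ext i j
    rw [T.zeros (notMem_bot _), SemistandardYoungTableau.zeros _ (notMem_bot _)]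
  · rintro rfl
    exact ⟨fun i j h => absurd h (notMem_bot _), fun u h => absurd h (notMem_bot _)⟩

/-! ### Diagrams determined by row or column lengths. -/

theorem eq_bot_of_colLen {mu : YoungDiagram} (h : mu.colLen 0 = 0) : mu = ⊥ := by
  refine le_bot_iff.1 ?_
  rintro ⟨i, j⟩ hij
  have := mem_iff_lt_colLen.1 (mu.up_left_mem le_rfl (Nat.zero_le j) hij)
  omega

theorem eq_bot_of_rowLen {mu : YoungDiagram} (h : mu.rowLen 0 = 0) : mu = ⊥ := by
  refine le_bot_iff.1 ?_
  rintro ⟨i, j⟩ hij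
  have := mem_iff_lt_rowLen.1 (mu.up_left_mem (Nat.zero_le i) le_rfl hij)
  omega

/-- An antitone tuple is the tuple of row lengths of a diagram. -/
theorem exists_rowLen {n : ℕ} {r : Fin n → ℕ} (hr : Antitone r) :
    ∃ nu : YoungDiagram, (∀ i : Fin n, nu.rowLen i = r i) ∧ ∀ i, n ≤ i → nu.rowLen i = 0 := by
  have hs : (List.ofFn r).SortedGE := hr.sortedGE_ofFn
  have key : ∀ i j, (i, j) ∈ ofRowLens (List.ofFn r) hs ↔ ∃ h : i < n, j < r ⟨i, h⟩ := by
    intro i j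
    rw [mem_ofRowLens]
    simp
  refine ⟨ofRowLens (List.ofFn r) hs, fun i => eq_of_forall_lt_iff fun j => ?_, fun i hi => ?_⟩
  · rw [← mem_iff_lt_rowLen, key]
    simp
  · by_contra h
    obtain ⟨h', -⟩ := (key i 0).1 (mem_iff_lt_rowLen.2 (Nat.pos_of_ne_zero h))
    omega

theorem exists_colLen {n : ℕ} {r : Fin n → ℕ} (hr : Antitone r) :
    ∃ nu : YoungDiagram, (∀ i : Fin n, nu.colLen i = r i) ∧ ∀ i, n ≤ i → nu.colLen i = 0 := by
  obtain ⟨nu, h1, h2⟩ := exists_rowLen hr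
  exact ⟨nu.transpose, fun i => by rw [colLen_transpose, h1],
    fun i hi => by rw [colLen_transpose, h2 i hi]⟩

theorem eq_of_rowLen_eq {mu nu : YoungDiagram} (h : ∀ i, mu.rowLen i = nu.rowLen i) : mu = nu := by
  ext ⟨i, j⟩
  rw [mem_cells, mem_cells, mem_iff_lt_rowLen, mem_iff_lt_rowLen, h]

theorem eq_of_colLen_eq {mu nu : YoungDiagram} (h : ∀ j, mu.colLen j = nu.colLen j) : mu = nu := by
  ext ⟨i, j⟩
  rw [mem_cells, mem_cells, mem_iff_lt_colLen, mem_iff_lt_colLen, h]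

theorem colLen_zero_le_iff {mu : YoungDiagram} {d : ℕ} : mu.colLen 0 ≤ d ↔ mu.rowLen d = 0 := by
  rw [← not_lt, ← mem_iff_lt_colLen, mem_iff_lt_rowLen, not_lt, Nat.le_zero]

theorem rowLen_zero_le_iff {mu : YoungDiagram} {d : ℕ} : mu.rowLen 0 ≤ d ↔ mu.colLen d = 0 := by
  rw [← not_lt, ← mem_iff_lt_rowLen, mem_iff_lt_colLen, not_lt, Nat.le_zero]

/-! ### The determinant formulas for flagged tableaux. -/

theorem ncard_flagged_eq_det_rowMatrix {a : ℕ → ℕ} (ha : Monotone a) (d : ℕ) (mu : YoungDiagram)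
    (hmu : mu.colLen 0 ≤ d) :
    ((flagged a d mu).ncard : ℤ) = (rowMatrix d (fun i => a (d - i)) mu.rowLen).det := by
  induction d generalizing mu with
  | zero =>
    obtain rfl := eq_bot_of_colLen (Nat.le_zero.1 hmu)
    rw [ncard_flagged_bot, Matrix.det_isEmpty, Nat.cast_one]
  | succ d ih =>
    rcases lt_or_ge (a (d + 1)) (mu.rowLen 0) with h0 | h0
    · rw [flagged_eq_empty_of_lt ha h0, Set.ncard_empty, det_rowMatrix_eq_zero, Nat.cast_zero]
      intro i _
      exact_mod_cast (ha (Nat.sub_le (d + 1) i)).trans_lt h0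
    · rw [ncard_flagged_succ h0, det_rowMatrix_succ (fun i j h => mu.rowLen_anti i j h)
        (by exact_mod_cast h0)]
      classical
      -- A ν with more than d rows carries no tableau; the others are encoded by d row lengths.
      rw [← Finset.sum_subset (Finset.filter_subset (fun nu => nu.colLen 0 ≤ d) _)
        fun nu hnu hnu' => ?_]
      swap
      · rw [flagged_eq_empty_of_lt_colLen, Set.ncard_empty]
        simpa [hnu] using hnu'
      push_cast
      refine Finset.sum_bij (fun nu _ (i : Fin d) => nu.rowLen i) ?_ ?_ ?_ ?_
      · intro nu hnu
        rw [Finset.mem_filter, mem_stripComplements_iff_rowLen] at hnu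
        simpa using fun i : Fin d => hnu.1 i
      · intro nu hnu nu' hnu' h
        refine eq_of_rowLen_eq fun i => ?_
        by_cases hi : i < d
        · exact congrFun h ⟨i, hi⟩
        · have h1 := colLen_zero_le_iff.1 (Finset.mem_filter.1 hnu).2
          have h2 := colLen_zero_le_iff.1 (Finset.mem_filter.1 hnu').2
          have h3 := nu.rowLen_anti d i (by omega)
          have h4 := nu'.rowLen_anti d i (by omega)
          omega
      · intro r hr
        simp only [Fintype.mem_piFinset, Finset.mem_Icc] at hr
        have hanti : Antitone r := by
          intro i j hij
          rcases hij.eq_or_lt with rfl | hij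
          · exact le_rfl
          · exact (hr j).2.trans ((mu.rowLen_anti _ _ hij).trans (hr i).1)
        obtain ⟨nu, h1, h2⟩ := exists_rowLen hanti
        refine ⟨nu, Finset.mem_filter.2 ⟨mem_stripComplements_iff_rowLen.2 fun i => ?_,
          colLen_zero_le_iff.2 (h2 d le_rfl)⟩, funext h1⟩
        by_cases hi : i < d
        · rw [h1 ⟨i, hi⟩]
          exact hr ⟨i, hi⟩
        · rw [h2 i (by omega)]
          have h3 := colLen_zero_le_iff.1 hmu
          have h4 := mu.rowLen_anti (d + 1) (i + 1) (by omega)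
          omega
      · intro nu hnu
        rw [ih nu (Finset.mem_filter.1 hnu).2]
        simp [rowMatrix]

/-- The number of `k ∈ {1, …, d}` with `i < a k`. -/
def flagCount (a : ℕ → ℕ) (d i : ℕ) : ℕ := ((Finset.Icc 1 d).filter fun k => i < a k).card

theorem flagCount_eq_zero {a : ℕ → ℕ} (ha : Monotone a) {d i : ℕ} (h : a d ≤ i) :
    flagCount a d i = 0 := by
  rw [flagCount, Finset.card_eq_zero, Finset.filter_eq_empty_iff]
  intro k hk
  have := ha (Finset.mem_Icc.1 hk).2
  omega

/-- When μ₁ ≤ a(d+1) this applies to every i < μ₁, so all upper indices rise by one together, as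
Pascal's rule needs. -/
theorem flagCount_succ {a : ℕ → ℕ} {d i : ℕ} (h : i < a (d + 1)) :
    flagCount a (d + 1) i = flagCount a d i + 1 := by
  rw [flagCount, flagCount, ← Finset.insert_Icc_right_eq_Icc_add_one (by omega),
    Finset.filter_insert, if_pos h, Finset.card_insert_of_notMem (by simp)]

theorem ncard_flagged_eq_det_colMatrix {a : ℕ → ℕ} (ha : Monotone a) (d : ℕ) (mu : YoungDiagram) :
    ((flagged a d mu).ncard : ℤ) =
      (colMatrix (mu.rowLen 0) (flagCount a d) mu.colLen).det := by
  have hpos : ∀ j < mu.rowLen 0, 0 < mu.colLen j := fun j hj =>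
    mem_iff_lt_colLen.1 (mem_iff_lt_rowLen.2 hj)
  have hzero : ∀ n, mu.rowLen 0 = n + 1 → flagCount a d n = 0 →
      (colMatrix (mu.rowLen 0) (flagCount a d) mu.colLen).det = 0 := by
    intro n hn h
    rw [hn]
    exact det_colMatrix_eq_zero h fun j hj => hpos j (by omega)
  induction d generalizing mu with
  | zero =>
    rcases hn : mu.rowLen 0 with _ | n
    · obtain rfl := eq_bot_of_rowLen hn
      rw [ncard_flagged_bot, Matrix.det_isEmpty, Nat.cast_one]
    · rw [← hn, hzero n hn (by simp [flagCount]), flagged_eq_empty_of_lt_colLen (hpos 0 (by omega)),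
        Set.ncard_empty, Nat.cast_zero]
  | succ d ih =>
    rcases lt_or_ge (a (d + 1)) (mu.rowLen 0) with h0 | h0
    · rw [flagged_eq_empty_of_lt ha h0, Set.ncard_empty, Nat.cast_zero,
        hzero (mu.rowLen 0 - 1) (by omega) (flagCount_eq_zero ha (by omega))]
    · rw [ncard_flagged_succ h0, det_colMatrix_pascal
        (fun i hi => flagCount_succ (d := d) (hi.trans_le h0)) hpos]
      classical
      rw [← Finset.sum_subset (Finset.filter_subset (fun r => Antitone r) _)
        fun r hr hr' => det_eq_zero_of_not_antitone (fun i j h => mu.colLen_anti i j h) hr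
          fun h => hr' (Finset.mem_filter.2 ⟨hr, h⟩)]
      push_cast
      have hmu : ∀ j, mu.rowLen 0 ≤ j → mu.colLen j = 0 := fun j hj => rowLen_zero_le_iff.1 hj
      refine Finset.sum_bij (fun nu _ (j : Fin (mu.rowLen 0)) => nu.colLen j) ?_ ?_ ?_ ?_
      · intro nu hnu
        rw [mem_stripComplements_iff_colLen] at hnu
        simpa using ⟨fun j : Fin (mu.rowLen 0) => hnu j,
          fun i j (hij : i ≤ j) => nu.colLen_anti i j hij⟩
      · intro nu hnu nu' hnu' h
        refine eq_of_colLen_eq fun j => ?_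
        by_cases hj : j < mu.rowLen 0
        · exact congrFun h ⟨j, hj⟩
        · have h1 := mem_stripComplements_iff_colLen.1 hnu j
          have h2 := mem_stripComplements_iff_colLen.1 hnu' j
          have := hmu j (by omega)
          omega
      · intro r hr
        simp only [Finset.mem_filter, Fintype.mem_piFinset, Finset.mem_Icc] at hr
        obtain ⟨nu, h1, h2⟩ := exists_colLen hr.2
        refine ⟨nu, mem_stripComplements_iff_colLen.2 fun j => ?_, funext h1⟩
        by_cases hj : j < mu.rowLen 0
        · rw [h1 ⟨j, hj⟩]
          have := hr.1 ⟨j, hj⟩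
          simp only at this
          omega
        · rw [h2 j (by omega), hmu j (by omega)]
          omega
      · intro nu hnu
        have hle : nu.rowLen 0 ≤ mu.rowLen 0 := (mem_stripComplements_iff_rowLen.1 hnu 0).2
        -- The induction hypothesis gives a matrix of size ν₁, which is padded to size μ₁.
        rw [ih nu (fun j hj => mem_iff_lt_colLen.1 (mem_iff_lt_rowLen.2 hj))
          (fun n hn h => by
            rw [hn]
            exact det_colMatrix_eq_zero h fun j hj =>
              mem_iff_lt_colLen.1 (mem_iff_lt_rowLen.2 (by omega))),
          ← det_colMatrix_eq hle fun j hj => rowLen_zero_le_iff.1 hj]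
        rfl

/-- Under k ↦ d - k, the letters k with j < a(k) become the rows of λ that meet column j. -/
theorem flagCount_rowLen (lam : YoungDiagram) (j : ℕ) :
    flagCount (fun k => lam.rowLen (lam.colLen 0 - k)) (lam.colLen 0) j = lam.colLen j := by
  rw [flagCount, ← Finset.card_range (lam.colLen j)]
  refine Finset.card_nbij' (fun k => lam.colLen 0 - k) (fun i => lam.colLen 0 - i) ?_ ?_ ?_ ?_
  · intro k hk
    simp only [Finset.coe_filter, Finset.mem_Icc, Set.mem_ofPred_eq] at hk
    simpa using mem_iff_lt_colLen.1 (mem_iff_lt_rowLen.2 hk.2)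
  · intro i hi
    have hi : i < lam.colLen j := by simpa using hi
    have h0 := lam.colLen_anti 0 j (Nat.zero_le j)
    have h1 := mem_iff_lt_rowLen.1 (mem_iff_lt_colLen.2 hi)
    simp only [Finset.coe_filter, Finset.mem_Icc, Set.mem_ofPred_eq]
    rw [Nat.sub_sub_self (by omega)]
    omega
  · intro k hk
    simp only [Finset.coe_filter, Finset.mem_Icc, Set.mem_ofPred_eq] at hk
    simp only
    omega
  · intro i hi
    have hi : i < lam.colLen j := by simpa using hi
    have h0 := lam.colLen_anti 0 j (Nat.zero_le j)
    simp only
    omega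

/-- Along a row the weights start out positive and drop by at most one in each step, so they are
all positive if none is zero. -/
theorem weight_pos {lam mu : YoungDiagram} {T : SemistandardYoungTableau mu}
    (h : ∀ u ∈ mu.cells, weight lam T u ≠ 0) {i j : ℕ}
    (hij : (i, j) ∈ mu) : 0 < weight lam T (i, j) := by
  refine lt_of_le_of_ne ?_ (h _ hij).symm
  induction j with
  | zero =>
    simp only [weight, content]
    omega
  | succ j ih =>
    have hc := mu.up_left_mem le_rfl (Nat.le_succ j) hij
    have h1 := lt_of_le_of_ne (ih hc) (h _ hc).symm
    have h2 := T.row_weak (Nat.lt_add_one j) hij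
    have h3 := lam.rowLen_anti (lam.colLen 0 - T i (j + 1)) (lam.colLen 0 - T i j) (by omega)
    simp only [weight, content] at h1 ⊢
    omega

theorem nonzeroTerms_eq_ooTableaux (lam mu : YoungDiagram) :
    nonzeroTerms lam mu = ooTableaux lam mu := by
  ext T
  refine and_congr_right fun _ => ?_
  rw [term, Finset.prod_ne_zero_iff]
  constructor
  · rintro h ⟨i, j⟩ hu
    have := weight_pos h hu
    simp only [weight] at this ⊢
    omega
  · intro h u hu
    have := h u hu
    simp only [weight]
    omega

end OkounkovOlshanski

theorem theorem1p2 (lam mu : YoungDiagram) (h : mu ≤ lam) :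
    (OkounkovOlshanski.nonzeroTerms lam mu).ncard = OkounkovOlshanski.oot lam mu ∧
    (OkounkovOlshanski.oot lam mu : ℤ) =
      Matrix.det (Matrix.of fun i j : Fin (lam.colLen 0) =>
        OkounkovOlshanski.binom
          ((lam.rowLen i : ℤ) - (mu.rowLen j : ℤ) + ((j : ℕ) : ℤ)) ((i : ℕ) : ℤ)) ∧
    (OkounkovOlshanski.oot lam mu : ℤ) =
      Matrix.det (Matrix.of fun i j : Fin (mu.rowLen 0) =>
        OkounkovOlshanski.binom
          (lam.colLen i : ℤ) ((mu.colLen j : ℤ) + ((i : ℕ) : ℤ) - ((j : ℕ) : ℤ))) := by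
  -- With rows counted from 0, this flag sends k to λ_{d+1-k}.
  have ha : Monotone fun k => lam.rowLen (lam.colLen 0 - k) := fun k k' hk =>
    lam.rowLen_anti _ _ (Nat.sub_le_sub_left hk _)
  have hcol : mu.colLen 0 ≤ lam.colLen 0 := by
    by_contra! hlt
    exact lt_irrefl _ (YoungDiagram.mem_iff_lt_colLen.1 (h (YoungDiagram.mem_iff_lt_colLen.2 hlt)))
  refine ⟨by rw [OkounkovOlshanski.nonzeroTerms_eq_ooTableaux]; rfl, ?_, ?_⟩
  · refine (OkounkovOlshanski.ncard_flagged_eq_det_rowMatrix ha _ mu hcol).trans ?_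
    congr 1
    ext i j
    simp only [OkounkovOlshanski.rowMatrix, Matrix.of_apply]
    rw [Nat.sub_sub_self i.2.le]
  · refine (OkounkovOlshanski.ncard_flagged_eq_det_colMatrix ha _ mu).trans ?_
    congr 1
    ext i j
    simp only [OkounkovOlshanski.colMatrix, Matrix.of_apply, OkounkovOlshanski.flagCount_rowLen]
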